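/- Let $n\ge 1$, let $|\cdot|$ be the Euclidean norm on $\mathbb R^n$ and $\mathbb S^{n-1}$ its unit sphere. Let $A$ be a real $n\times n$ matrix that is diagonalizable over $\mathbb R$ and whose eigenvalues are all positive. Let $\alpha>0$ and let $H:\mathbb R^n\setminus\{0\}\to\mathbb R$ be positively homogeneous of degree $\alpha$ (that is, $H(sx)=s^\alpha H(x)$ for all $x\neq 0$, $s>0$), and positive and continuous on $\mathbb S^{n-1}$. Assume that $H$ has property (HC) on $\mathbb S^{n-1}$: for every $x_0\in\mathbb S^{n-1}$ there are numbers $r,C,\gamma>0$ such that $|H(x)-H(x_0)|\le C|x-x_0|^\gamma$ for all $x\in\mathbb S^{n-1}$ with $|x-x_0|<r$. Let $0\le t_0<T_*<\infty$, and let $y\in C^1([t_0,T_*),\mathbb R^n)$ satisfy $y(t)\ne 0$ for all $t\in[t_0,T_*)$, $\lim_{t\to T_*^-}|y(t)|=\infty$, and $$y'(t)=H(y(t))\,Ay(t)+f(t)\quad\text{for } t\in(t_0,T_*),$$ where $f:[t_0,T_*)\to\mathbb R^n$ is continuous and, for some numbers $M,\delta>0$, $$|f(t)|\le |y(t)|^{1+\alpha}\,M(T_*-t)^\delta\quad\text{for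 all } t\in[t_0,T_*).$$ Then there exist an eigenvalue $\Lambda$ of $A$ and an eigenvector $\xi_*$ of $A$ associated with $\Lambda$ such that $\alpha\Lambda H(\xi_*)=1$ and, for some number $\varepsilon_*>0$, $$\left|(T_*-t)^{1/\alpha}y(t)-\xi_*\right|=\mathcal O\big((T_*-t)^{\varepsilon_*}\big)\quad\text{as } t\to T_*^-.$$ -/

import Mathlib

open Filter Topology Set Asymptotics

/-- `A` is diagonalizable over the reals: `A = S⁻¹ A₀ S` with `S` real invertible and `A₀` real
diagonal. -/
def RealDiagonalizable {n : ℕ} (A : Matrix (Fin n) (Fin n) ℝ) : Prop :=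
  ∃ (S : Matrix (Fin n) (Fin n) ℝ) (d : Fin n → ℝ),
    IsUnit S ∧ A = S⁻¹ * Matrix.diagonal d * S

/-- `F` is positively homogeneous of degree `β` on `ℝⁿ ∖ {0}`; the value `F 0` plays no role. -/
def PosHomogeneous {n : ℕ} (β : ℝ) (F : EuclideanSpace ℝ (Fin n) → ℝ) : Prop :=
  ∀ x : EuclideanSpace ℝ (Fin n), x ≠ 0 → ∀ t : ℝ, 0 < t → F (t • x) = t ^ β * F x

/-- Property (HC) on `E`: a Hölder-type estimate at each point `x₀` of `E`, where the radius, the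
constant and the exponent may depend on `x₀`. -/
def PropertyHC {n : ℕ} (E : Set (EuclideanSpace ℝ (Fin n)))
    (F : EuclideanSpace ℝ (Fin n) → ℝ) : Prop :=
  ∀ x₀ ∈ E, ∃ r C γ : ℝ, 0 < r ∧ 0 < C ∧ 0 < γ ∧
    ∀ x ∈ E, ‖x - x₀‖ < r → |F x - F x₀| ≤ C * ‖x - x₀‖ ^ γ

/-- `y ∈ C¹([t₀, T), ℝⁿ)` is nowhere zero, satisfies `y' = H(y) A y + f` on `(t₀, T)`, and
`|y(t)| → ∞` as `t → T⁻`. -/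
structure IsBlowUpSolution {n : ℕ} (A : Matrix (Fin n) (Fin n) ℝ)
    (H : EuclideanSpace ℝ (Fin n) → ℝ) (f : ℝ → EuclideanSpace ℝ (Fin n)) (t₀ T : ℝ)
    (y : ℝ → EuclideanSpace ℝ (Fin n)) : Prop where
  contDiffOn : ContDiffOn ℝ 1 y (Ico t₀ T)
  ne_zero : ∀ t ∈ Ico t₀ T, y t ≠ 0
  hasDerivAt : ∀ t ∈ Ioo t₀ T,
    HasDerivAt y (H (y t) • Matrix.toEuclideanLin A (y t) + f t) t
  tendsto_norm : Tendsto (fun t => ‖y t‖) (𝓝[<] T) atTop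

/-! Diagonalize `A` by `z = P y` and use polar coordinates `N = |z|`, `v = z / N`. The equation
becomes that of `exists_powConv_polar`, with `k = H (y / N)` between positive constants. Two-sided
bounds on the derivative of `N ^ (-α)`, which vanishes at `T`, show that `N ^ α` is comparable to `1
/ (T - t)`. In the time `-log (T - t)` the direction then follows a projected linear flow with
bounded positive speed and an exponentially small error. The Rayleigh quotient `∑ d j * v j ^ 2` is
nondecreasing along this flow up to an integrable error, so it has a limit `Λ`, at first without a
rate. Modes with `d i ≠ Λ` are uniformly stable or unstable and, being bounded, decay like a power
of `T - t`. This gives a rate for the Rayleigh quotient, makes the derivatives of the remaining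
modes integrable, and hence the whole direction converges (`exists_powConv_direction`). By (HC) and
homogeneity `k` converges at a power rate too; integrating the equation of `N ^ (-α)` gives the
limit of `N ^ (-α) / (T - t)`. Size and direction together give `ξ`. -/

/-- `f` converges to `L` at `T` from the left, at the rate of a positive power of `T - t`. -/
def PowConv {E : Type*} [NormedAddCommGroup E] (T : ℝ) (f : ℝ → E) (L : E) : Prop :=
  ∃ ε : ℝ, 0 < ε ∧ (fun t => f t - L) =O[𝓝[<] T] (fun t => (T - t) ^ ε)

/-! ### Calculus of convergence at a power rate -/

theorem eventually_sub_pos (T : ℝ) : ∀ᶠ t in 𝓝[<] T, 0 < T - t := by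
  filter_upwards [self_mem_nhdsWithin] with t ht
  exact sub_pos.2 ht

theorem tendsto_sub_rpow (T : ℝ) {ε : ℝ} (hε : 0 < ε) :
    Tendsto (fun t => (T - t) ^ ε) (𝓝[<] T) (𝓝 0) := by
  have h : ContinuousAt (fun t => (T - t) ^ ε) T :=
    (continuousAt_const.sub continuousAt_id).rpow_const (Or.inr hε.le)
  have h2 := h.tendsto
  simp only [sub_self, Real.zero_rpow hε.ne'] at h2
  exact h2.mono_left nhdsWithin_le_nhds

theorem eventually_sub_lt (T : ℝ) {η : ℝ} (hη : 0 < η) : ∀ᶠ t in 𝓝[<] T, T - t < η := by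
  filter_upwards [(tendsto_sub_rpow T one_pos).eventually (gt_mem_nhds hη)] with t ht
  simpa using ht

theorem sub_rpow_isBigO (T : ℝ) {ε δ : ℝ} (h : ε ≤ δ) :
    (fun t => (T - t) ^ δ) =O[𝓝[<] T] (fun t => (T - t) ^ ε) := by
  refine IsBigO.of_bound 1 ?_
  filter_upwards [eventually_sub_pos T, eventually_sub_lt T one_pos] with t h0 h1
  rw [Real.norm_of_nonneg (by positivity), Real.norm_of_nonneg (by positivity), one_mul]
  exact Real.rpow_le_rpow_of_exponent_ge h0 h1.le h

namespace PowConv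

variable {E F : Type*} [NormedAddCommGroup E] [NormedAddCommGroup F] {T : ℝ}

theorem tendsto {f : ℝ → E} {L : E} (h : PowConv T f L) : Tendsto f (𝓝[<] T) (𝓝 L) := by
  obtain ⟨ε, hε, h⟩ := h
  simpa using (h.trans_tendsto (tendsto_sub_rpow T hε)).add_const L

theorem bound {f : ℝ → E} (h : PowConv T f 0) :
    ∃ ε C : ℝ, 0 < ε ∧ 0 < C ∧ ∀ᶠ t in 𝓝[<] T, ‖f t‖ ≤ C * (T - t) ^ ε := by
  obtain ⟨ε, hε, h⟩ := h
  obtain ⟨C, hC, h⟩ := h.exists_pos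
  refine ⟨ε, C, hε, hC, ?_⟩
  filter_upwards [h.bound, eventually_sub_pos T] with t h1 h2
  rwa [sub_zero, Real.norm_of_nonneg (by positivity)] at h1

theorem of_bound {f : ℝ → E} {L : E} {ε C : ℝ} (hε : 0 < ε)
    (h : ∀ᶠ t in 𝓝[<] T, ‖f t - L‖ ≤ C * (T - t) ^ ε) : PowConv T f L := by
  refine ⟨ε, hε, IsBigO.of_bound C ?_⟩
  filter_upwards [h, eventually_sub_pos T] with t h1 h2
  rwa [Real.norm_of_nonneg (by positivity)]

theorem const (L : E) : PowConv T (fun _ => L) L :=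
  of_bound (ε := 1) (C := 0) one_pos (by simp)

theorem congr' {f g : ℝ → E} {L : E} (h : PowConv T f L) (hfg : f =ᶠ[𝓝[<] T] g) :
    PowConv T g L := by
  obtain ⟨ε, hε, h⟩ := h
  exact ⟨ε, hε, h.congr' (hfg.mono fun t ht => by simp [ht]) EventuallyEq.rfl⟩

theorem of_isBigO {f : ℝ → E} {L : E} {g : ℝ → F} {L' : F} (hg : PowConv T g L')
    (h : (fun t => f t - L) =O[𝓝[<] T] fun t => g t - L') : PowConv T f L := by
  obtain ⟨ε, hε, hg⟩ := hg
  exact ⟨ε, hε, h.trans hg⟩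

theorem prodMk {f : ℝ → E} {g : ℝ → F} {L : E} {L' : F} (hf : PowConv T f L)
    (hg : PowConv T g L') : PowConv T (fun t => (f t, g t)) (L, L') := by
  obtain ⟨ε, hε, hf⟩ := hf
  obtain ⟨δ, hδ, hg⟩ := hg
  exact ⟨min ε δ, lt_min hε hδ,
    (hf.trans (sub_rpow_isBigO T (min_le_left _ _))).prod_left
      (hg.trans (sub_rpow_isBigO T (min_le_right _ _)))⟩

theorem comp_differentiableAt [NormedSpace ℝ E] [NormedSpace ℝ F] {f : ℝ → E} {L : E}
    (hf : PowConv T f L) {φ : E → F} (hφ : DifferentiableAt ℝ φ L) :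
    PowConv T (fun t => φ (f t)) (φ L) :=
  hf.of_isBigO (hφ.isBigO_sub.comp_tendsto hf.tendsto)

theorem norm {f : ℝ → E} {L : E} (hf : PowConv T f L) : PowConv T (fun t => ‖f t‖) ‖L‖ :=
  hf.of_isBigO (IsBigO.of_bound 1 (Eventually.of_forall fun t => by
    simpa using abs_norm_sub_norm_le (f t) L))

theorem add {f g : ℝ → E} {L L' : E} (hf : PowConv T f L) (hg : PowConv T g L') :
    PowConv T (fun t => f t + g t) (L + L') := by
  refine (hf.prodMk hg).of_isBigO ?_
  refine IsBigO.of_bound 2 (Eventually.of_forall fun t => ?_)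
  have h1 := norm_fst_le ((f t, g t) - (L, L'))
  have h2 := norm_snd_le ((f t, g t) - (L, L'))
  have h3 := norm_add_le (f t - L) (g t - L')
  simp only [Prod.fst_sub, Prod.snd_sub] at h1 h2
  rw [add_sub_add_comm]
  linarith

theorem sum {ι : Type*} (s : Finset ι) {f : ι → ℝ → E} {L : ι → E}
    (hf : ∀ i ∈ s, PowConv T (f i) (L i)) :
    PowConv T (fun t => ∑ i ∈ s, f i t) (∑ i ∈ s, L i) := by
  classical
  induction s using Finset.induction_on with
  | empty => simpa using const (T := T) (0 : E)
  | insert a s ha ih =>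
    simp only [Finset.sum_insert ha]
    exact (hf a (Finset.mem_insert_self a s)).add
      (ih fun i hi => hf i (Finset.mem_insert_of_mem hi))

theorem smul [NormedSpace ℝ E] {c : ℝ → ℝ} {f : ℝ → E} {l : ℝ} {L : E} (hc : PowConv T c l)
    (hf : PowConv T f L) : PowConv T (fun t => c t • f t) (l • L) :=
  (hc.prodMk hf).comp_differentiableAt (φ := fun p : ℝ × E => p.1 • p.2) (by fun_prop)

theorem mul {c f : ℝ → ℝ} {l L : ℝ} (hc : PowConv T c l)
    (hf : PowConv T f L) : PowConv T (fun t => c t * f t) (l * L) := hc.smul hf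

theorem zero_of_le {f : ℝ → E} {g : ℝ → F} {C : ℝ} (hg : PowConv T g 0)
    (h : ∀ᶠ t in 𝓝[<] T, ‖f t‖ ≤ C * ‖g t‖) : PowConv T f 0 :=
  hg.of_isBigO (by simpa using IsBigO.of_bound C h)

/-- The rate exponent is multiplied by the Hölder exponent, and the estimate is needed only at the
limit point. -/
theorem comp_holder {f : ℝ → E} {L : E} (hf : PowConv T f L) {φ : E → ℝ} {s : Set E}
    (hs : ∀ᶠ t in 𝓝[<] T, f t ∈ s) {r C γ : ℝ} (hr : 0 < r) (hγ : 0 < γ) (hC : 0 < C)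
    (hφ : ∀ x ∈ s, ‖x - L‖ < r → |φ x - φ L| ≤ C * ‖x - L‖ ^ γ) :
    PowConv T (fun t => φ (f t)) (φ L) := by
  have hlim := hf.tendsto
  obtain ⟨ε, hε, hf⟩ := hf
  obtain ⟨K, hK, hf⟩ := hf.exists_pos
  refine of_bound (ε := ε * γ) (C := C * K ^ γ) (by positivity) ?_
  filter_upwards [hf.bound, hs, hlim.eventually (Metric.ball_mem_nhds L hr),
    eventually_sub_pos T] with t h1 h2 h3 h4
  rw [Real.norm_of_nonneg (by positivity)] at h1
  refine (hφ _ h2 (by rwa [← dist_eq_norm])).trans ?_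
  rw [mul_assoc, Real.rpow_mul h4.le, ← Real.mul_rpow hK.le (by positivity)]
  gcongr

end PowConv

/-! ### Differential inequalities up to the endpoint -/

theorem exists_Ioo_of_eventually {T : ℝ} {p : ℝ → Prop} (h : ∀ᶠ t in 𝓝[<] T, p t) :
    ∃ a < T, ∀ t ∈ Ioo a T, p t := by
  obtain ⟨a, ha, h⟩ := mem_nhdsLT_iff_exists_Ioo_subset.1 h
  exact ⟨a, ha, h⟩

theorem monotoneOn_Ioo_of_hasDerivAt {u u' : ℝ → ℝ} {a b : ℝ}
    (h : ∀ t ∈ Ioo a b, HasDerivAt u (u' t) t ∧ 0 ≤ u' t) : MonotoneOn u (Ioo a b) := by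
  refine monotoneOn_of_deriv_nonneg (convex_Ioo a b)
    (fun t ht => (h t ht).1.continuousAt.continuousWithinAt)
    (fun t ht => ?_) (fun t ht => ?_)
  · rw [interior_Ioo] at ht
    exact (h t ht).1.differentiableAt.differentiableWithinAt
  · rw [interior_Ioo] at ht
    rw [(h t ht).1.deriv]
    exact (h t ht).2

theorem hasDerivAt_sub_rpow {T t : ℝ} (ht : 0 < T - t) (δ : ℝ) :
    HasDerivAt (fun t => (T - t) ^ δ) (-(δ * (T - t) ^ (δ - 1))) t := by
  have h := ((hasDerivAt_id t).const_sub T).rpow_const (p := δ) (Or.inl ht.ne')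
  refine h.congr_deriv ?_
  simp only [id]
  ring

/-- Subtracting `C / δ * (T - t) ^ δ`, a primitive of the lower bound on the derivative, makes `u`
monotone and keeps it bounded above; the correction vanishes at `T`. -/
theorem exists_tendsto_of_deriv_ge {T : ℝ} {u u' : ℝ → ℝ} {C δ B : ℝ} (hδ : 0 < δ)
    (hu : ∀ᶠ t in 𝓝[<] T, HasDerivAt u (u' t) t)
    (hu' : ∀ᶠ t in 𝓝[<] T, -(C * (T - t) ^ (δ - 1)) ≤ u' t)
    (hB : ∀ᶠ t in 𝓝[<] T, u t ≤ B) :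
    ∃ L, Tendsto u (𝓝[<] T) (𝓝 L) ∧ ∀ᶠ t in 𝓝[<] T, u t - C / δ * (T - t) ^ δ ≤ L := by
  obtain ⟨a, ha, h⟩ := exists_Ioo_of_eventually
    (hu.and (hu'.and (hB.and ((eventually_sub_pos T).and (eventually_sub_lt T one_pos)))))
  have hmono : MonotoneOn (fun t => u t - C / δ * (T - t) ^ δ) (Ioo a T) := by
    refine monotoneOn_Ioo_of_hasDerivAt
      (u' := fun t => u' t - C / δ * -(δ * (T - t) ^ (δ - 1))) fun t ht => ?_
    obtain ⟨h1, h2, -, h4, -⟩ := h t ht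
    refine ⟨h1.sub ((hasDerivAt_sub_rpow h4 δ).const_mul _), ?_⟩
    field_simp
    linarith
  have hbdd : BddAbove ((fun t => u t - C / δ * (T - t) ^ δ) '' Ioo a T) := by
    refine ⟨B + |C / δ|, ?_⟩
    rintro _ ⟨t, ht, rfl⟩
    obtain ⟨-, -, h3, h4, h5⟩ := h t ht
    have h6 : |C / δ * (T - t) ^ δ| ≤ |C / δ| * 1 := by
      rw [abs_mul, abs_of_pos (Real.rpow_pos_of_pos h4 δ)]
      gcongr
      exact Real.rpow_le_one h4.le h5.le hδ.le
    have := neg_abs_le (C / δ * (T - t) ^ δ)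
    simp only
    linarith
  have hlim := hmono.tendsto_nhdsWithin_Ioo_left (nonempty_Ioo.2 ha) hbdd
  refine ⟨sSup ((fun t => u t - C / δ * (T - t) ^ δ) '' Ioo a T), ?_, ?_⟩
  · simpa using hlim.add ((tendsto_sub_rpow T hδ).const_mul (C / δ))
  · filter_upwards [Ioo_mem_nhdsLT ha] with t ht
    exact le_csSup hbdd (mem_image_of_mem _ ht)

theorem exists_abs_sub_le_of_abs_deriv_le {T : ℝ} {u u' : ℝ → ℝ} {C δ B : ℝ} (hδ : 0 < δ)
    (hu : ∀ᶠ t in 𝓝[<] T, HasDerivAt u (u' t) t)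
    (hu' : ∀ᶠ t in 𝓝[<] T, |u' t| ≤ C * (T - t) ^ (δ - 1))
    (hB : ∀ᶠ t in 𝓝[<] T, |u t| ≤ B) :
    ∃ L, Tendsto u (𝓝[<] T) (𝓝 L) ∧ ∀ᶠ t in 𝓝[<] T, |u t - L| ≤ C / δ * (T - t) ^ δ := by
  obtain ⟨L, hL, h1⟩ := exists_tendsto_of_deriv_ge hδ hu (hu'.mono fun t ht => (abs_le.1 ht).1)
    (hB.mono fun t ht => (abs_le.1 ht).2)
  obtain ⟨L', hL', h2⟩ := exists_tendsto_of_deriv_ge (u := fun t => -u t) (u' := fun t => -u' t) hδ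
    (hu.mono fun t ht => ht.neg) (hu'.mono fun t ht => neg_le_neg (abs_le.1 ht).2)
    (hB.mono fun t ht => neg_le.1 (abs_le.1 ht).1)
  obtain rfl : L' = -L := tendsto_nhds_unique hL' hL.neg
  refine ⟨L, hL, ?_⟩
  filter_upwards [h1, h2] with t h1 h2
  rw [abs_le]
  constructor <;> linarith

/-- The factor `T - t` turns the derivative into the one in logarithmic time `-log (T - t)`; its
power decay makes `u'` integrable up to `T`. -/
theorem PowConv.exists_of_deriv {T : ℝ} {u u' : ℝ → ℝ} {B : ℝ}
    (hu : ∀ᶠ t in 𝓝[<] T, HasDerivAt u (u' t) t)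
    (hu' : PowConv T (fun t => (T - t) * u' t) 0)
    (hB : ∀ᶠ t in 𝓝[<] T, |u t| ≤ B) : ∃ L, PowConv T u L := by
  obtain ⟨ε, C, hε, hC, h⟩ := hu'.bound
  obtain ⟨L, -, hL⟩ := exists_abs_sub_le_of_abs_deriv_le (C := C) hε hu (by
    filter_upwards [h, eventually_sub_pos T] with t h1 h2
    rw [Real.rpow_sub_one h2.ne', ← mul_div_assoc, le_div_iff₀ h2]
    rw [Real.norm_eq_abs, abs_mul, abs_of_pos h2] at h1
    linarith) hB
  exact ⟨L, .of_bound hε hL⟩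

/-- If `m` vanishes at `T` and its derivative converges, so does the quotient `m / (T - t)`. -/
theorem PowConv.div_sub_of_deriv {T c : ℝ} {m m' : ℝ → ℝ}
    (hm : ∀ᶠ t in 𝓝[<] T, HasDerivAt m (m' t) t) (hm' : PowConv T m' (-c))
    (h0 : Tendsto m (𝓝[<] T) (𝓝 0)) : PowConv T (fun t => m t / (T - t)) c := by
  have h1 := hm'.add (PowConv.const c)
  rw [neg_add_cancel] at h1
  obtain ⟨ε, C, hε, hC, h1⟩ := h1.bound
  have h2 : Tendsto (fun t => m t - c * (T - t)) (𝓝[<] T) (𝓝 0) := by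
    simpa using h0.sub ((tendsto_sub_rpow T one_pos).const_mul c)
  have hB : ∀ᶠ t in 𝓝[<] T, |m t - c * (T - t)| ≤ 1 := by
    filter_upwards [h2.eventually (Metric.ball_mem_nhds 0 one_pos)] with t ht
    simpa using (mem_ball_zero_iff.1 ht).le
  -- The exponent `ε + 1` leaves a rate `ε` after division by `T - t`.
  obtain ⟨L, hL, h3⟩ := exists_abs_sub_le_of_abs_deriv_le (C := C) (δ := ε + 1)
    (u := fun t => m t - c * (T - t)) (u' := fun t => m' t + c) (by linarith) (by
      filter_upwards [hm] with t ht
      have := ht.sub (((hasDerivAt_id t).const_sub T).const_mul c)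
      exact this.congr_deriv (by ring)) (by simpa using h1) hB
  obtain rfl := tendsto_nhds_unique hL h2
  refine .of_bound hε (C := C / (ε + 1)) ?_
  filter_upwards [h3, eventually_sub_pos T] with t h3 h4
  rw [Real.rpow_add_one h4.ne', ← mul_assoc, sub_zero] at h3
  have : m t / (T - t) - c = (m t - c * (T - t)) / (T - t) := by field_simp
  rwa [this, Real.norm_eq_abs, abs_div, abs_of_pos h4, div_le_iff₀ h4]

theorem PowConv.of_sq {T : ℝ} {u : ℝ → ℝ} (h : PowConv T (fun t => u t ^ 2) 0) :
    PowConv T u 0 := by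
  obtain ⟨ε, C, hε, hC, h⟩ := h.bound
  refine .of_bound (ε := ε / 2) (C := √C) (by positivity) ?_
  filter_upwards [h, eventually_sub_pos T] with t h1 h2
  rw [sub_zero, Real.norm_eq_abs]
  refine abs_le_of_sq_le_sq ?_ (by positivity)
  rw [mul_pow, Real.sq_sqrt hC.le, ← Real.rpow_mul_natCast h2.le]
  simp only [Real.norm_eq_abs, abs_pow, sq_abs] at h1
  simpa using h1

/-! ### Stable and unstable scalar modes -/

/-- In logarithmic time the linear rate is at most `-μ` and the forcing decays exponentially, so `u
^ 2 * (T - t) ^ (-ε)` stays bounded for small `ε`. -/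
theorem PowConv.zero_of_stable {T μ B : ℝ} {u a b : ℝ → ℝ} (hμ : 0 < μ)
    (hu : ∀ᶠ t in 𝓝[<] T, HasDerivAt u (a t * u t + b t) t)
    (ha : ∀ᶠ t in 𝓝[<] T, (T - t) * a t ≤ -μ)
    (hb : PowConv T (fun t => (T - t) * b t) 0)
    (hB : ∀ᶠ t in 𝓝[<] T, |u t| ≤ B) : PowConv T u 0 := by
  obtain ⟨δ, C, hδ, hC, hb⟩ := hb.bound
  -- `ε ≤ μ` lets the damping absorb the derivative of the weight; `ε < δ` keeps the forcing
  -- integrable after weighting.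
  set ε := min μ (δ / 2) with hεdef
  have hε : 0 < ε := by positivity
  have hεμ : ε ≤ μ := min_le_left _ _
  have hεδ : ε < δ := (min_le_right _ _).trans_lt (by linarith)
  set K := 2 * C * B
  -- the function `u ^ 2 * (T - t) ^ (-ε)` has a derivative bounded above by an integrable power
  have h1 : ∀ᶠ t in 𝓝[<] T, HasDerivAt (fun t => -(u t ^ 2 * (T - t) ^ (-ε)))
      (-(2 * u t * (a t * u t + b t) * (T - t) ^ (-ε)
        + u t ^ 2 * -(-ε * (T - t) ^ (-ε - 1)))) t := by
    filter_upwards [hu, eventually_sub_pos T] with t h1 h2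
    have := ((h1.pow 2).mul (hasDerivAt_sub_rpow h2 (-ε))).neg
    exact this.congr_deriv (by simp)
  obtain ⟨L, hL, -⟩ := exists_tendsto_of_deriv_ge (C := K) (δ := δ - ε) (B := 0) (by linarith)
    h1 (by
      filter_upwards [ha, hb, hB, eventually_sub_pos T] with t ha hb hB h4
      have hsplit : (T - t) ^ (-ε) = (T - t) ^ (-ε - 1) * (T - t) := by
        rw [Real.rpow_sub_one h4.ne']; field_simp
      have hsplit2 : (T - t) ^ (δ - ε - 1) = (T - t) ^ (-ε - 1) * (T - t) ^ δ := by
        rw [← Real.rpow_add h4]; ring_nf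
      have hp : 0 < (T - t) ^ (-ε - 1) := Real.rpow_pos_of_pos h4 _
      rw [hsplit, hsplit2]
      have h5 : u t * ((T - t) * b t) ≤ B * (C * (T - t) ^ δ) := by
        refine (le_abs_self _).trans ?_
        rw [abs_mul]
        exact mul_le_mul hB hb (abs_nonneg _) ((abs_nonneg _).trans hB)
      have h6 : u t ^ 2 * ((T - t) * a t) ≤ u t ^ 2 * -μ :=
        mul_le_mul_of_nonneg_left ha (sq_nonneg _)
      have h7 : u t ^ 2 * ε ≤ u t ^ 2 * μ := mul_le_mul_of_nonneg_left hεμ (sq_nonneg _)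
      have h8 : 0 ≤ u t ^ 2 * μ := by positivity
      have h9 : 0 ≤ (T - t) ^ (-ε - 1) * (2 * (B * (C * (T - t) ^ δ))
          - 2 * (u t * ((T - t) * b t)) - 2 * (u t ^ 2 * ((T - t) * a t)) - u t ^ 2 * ε) :=
        mul_nonneg hp.le (by linarith)
      simp only [K]
      linarith)
    (by
      filter_upwards [eventually_sub_pos T] with t ht
      have : 0 ≤ u t ^ 2 * (T - t) ^ (-ε) := by positivity
      linarith)
  refine .of_sq (.of_bound hε (C := -L + 1) ?_)
  filter_upwards [hL.eventually (lt_mem_nhds (sub_one_lt L)), eventually_sub_pos T] with t h1 h2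
  rw [sub_zero, Real.norm_of_nonneg (sq_nonneg _)]
  rw [Real.rpow_neg h2.le, ← div_eq_mul_inv, lt_neg, div_lt_iff₀ (by positivity)] at h1
  linarith

/-- A growing mode stays bounded only if it is slaved to the forcing. The bound is carried back from
`T`: `(u ^ 2 - K * (T - t) ^ δ) * (T - t) ^ μ` is nondecreasing, and boundedness of `u` forces its
limit at `T` to be at most zero. -/
theorem PowConv.zero_of_unstable {T μ B : ℝ} {u a b : ℝ → ℝ} (hμ : 0 < μ)
    (hu : ∀ᶠ t in 𝓝[<] T, HasDerivAt u (a t * u t + b t) t)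
    (ha : ∀ᶠ t in 𝓝[<] T, μ ≤ (T - t) * a t)
    (hb : PowConv T (fun t => (T - t) * b t) 0)
    (hB : ∀ᶠ t in 𝓝[<] T, |u t| ≤ B) : PowConv T u 0 := by
  obtain ⟨δ, C, hδ, hC, hb⟩ := hb.bound
  -- With `K * δ = 2 * C * B` the derivative of the correction cancels the forcing term `2 * u * b`.
  set K := 2 * C * B / δ with hK
  obtain ⟨s, hs, h⟩ := exists_Ioo_of_eventually
    (hu.and (ha.and (hb.and (hB.and (eventually_sub_pos T)))))
  have hmono : MonotoneOn (fun t => (u t ^ 2 - K * (T - t) ^ δ) * (T - t) ^ μ) (Ioo s T) := by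
    refine monotoneOn_Ioo_of_hasDerivAt
      (u' := fun t => (2 * u t * (a t * u t + b t) - K * -(δ * (T - t) ^ (δ - 1))) * (T - t) ^ μ
        + (u t ^ 2 - K * (T - t) ^ δ) * -(μ * (T - t) ^ (μ - 1))) fun t ht => ?_
    obtain ⟨h1, ha, hb, hB, h4⟩ := h t ht
    constructor
    · have := ((h1.pow 2).sub ((hasDerivAt_sub_rpow h4 δ).const_mul K)).mul
        (hasDerivAt_sub_rpow h4 μ)
      exact this.congr_deriv (by simp)
    · have hsplit : (T - t) ^ μ = (T - t) ^ (μ - 1) * (T - t) := by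
        rw [Real.rpow_sub_one h4.ne']; field_simp
      have hsplit2 : (T - t) ^ δ = (T - t) ^ (δ - 1) * (T - t) := by
        rw [Real.rpow_sub_one h4.ne']; field_simp
      have hB0 : 0 ≤ B := (abs_nonneg _).trans hB
      have h5 : -(u t * ((T - t) * b t)) ≤ B * (C * (T - t) ^ δ) := by
        refine (neg_le_abs _).trans ?_
        rw [abs_mul]
        exact mul_le_mul hB hb (abs_nonneg _) hB0
      have h6 : u t ^ 2 * μ ≤ u t ^ 2 * ((T - t) * a t) :=
        mul_le_mul_of_nonneg_left ha (sq_nonneg _)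
      have h8 : 0 ≤ u t ^ 2 * μ := by positivity
      have h10 : K * δ = 2 * C * B := by rw [hK]; field_simp
      have h11 : 0 ≤ K * (T - t) ^ δ * μ := by positivity
      have h9 : 0 ≤ (T - t) ^ (μ - 1) * (2 * (u t * ((T - t) * b t))
          + 2 * (u t ^ 2 * ((T - t) * a t)) + K * δ * (T - t) ^ δ - u t ^ 2 * μ
          + K * (T - t) ^ δ * μ) :=
        mul_nonneg (by positivity) (by rw [h10]; linarith)
      refine h9.trans_eq ?_
      rw [hsplit, hsplit2]
      ring
  have hlim : Tendsto (fun t => (B ^ 2 + |K| * (T - t) ^ δ) * (T - t) ^ μ) (𝓝[<] T) (𝓝 0) := by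
    simpa using (((tendsto_sub_rpow T hδ).const_mul |K|).const_add (B ^ 2)).mul
      (tendsto_sub_rpow T hμ)
  refine .of_sq (.of_bound hδ (C := K) ?_)
  filter_upwards [Ioo_mem_nhdsLT hs] with t ht
  have h4 := (h t ht).2.2.2.2
  rw [sub_zero, Real.norm_of_nonneg (sq_nonneg _)]
  have : (u t ^ 2 - K * (T - t) ^ δ) * (T - t) ^ μ ≤ 0 := by
    refine ge_of_tendsto hlim ?_
    filter_upwards [Ioo_mem_nhdsLT ht.2] with r hr
    have hr' : r ∈ Ioo s T := ⟨ht.1.trans hr.1, hr.2⟩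
    obtain ⟨-, -, -, hB, h5⟩ := h r hr'
    refine (hmono ht hr' hr.1.le).trans ?_
    have h6 : u r ^ 2 ≤ B ^ 2 := sq_le_sq' (abs_le.1 hB).1 (abs_le.1 hB).2
    have h7 : -K * (T - r) ^ δ ≤ |K| * (T - r) ^ δ := by
      gcongr
      exact neg_le_abs K
    simp only
    gcongr
    linarith
  have h8 := nonpos_of_mul_nonpos_left this (Real.rpow_pos_of_pos h4 μ)
  linarith

theorem PowConv.zero_mul_of_bound {T B : ℝ} {f g : ℝ → ℝ} (hg : PowConv T g 0)
    (hf : ∀ᶠ t in 𝓝[<] T, |f t| ≤ B) : PowConv T (fun t => f t * g t) 0 := by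
  refine hg.zero_of_le (C := B) ?_
  filter_upwards [hf] with t ht
  rw [norm_mul]
  gcongr
  exact ht

/-! ### Convergence of the direction -/

/-- A unit vector `v` that follows the projected linear flow of a diagonal matrix, up to a small
perturbation `e`, converges to an eigenvector of that matrix. -/
theorem exists_powConv_direction {ι : Type*} [Fintype ι] {T a b : ℝ} (ha : 0 < a)
    (d : ι → ℝ) (v e : ι → ℝ → ℝ) (K : ℝ → ℝ)
    (hv : ∀ᶠ t in 𝓝[<] T, ∑ i, v i t ^ 2 = 1)
    (hd : ∀ᶠ t in 𝓝[<] T, ∀ i,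
      HasDerivAt (v i) (K t * (d i - ∑ j, d j * v j t ^ 2) * v i t + e i t) t)
    (hK : ∀ᶠ t in 𝓝[<] T, a ≤ (T - t) * K t ∧ (T - t) * K t ≤ b)
    (he : ∀ i, PowConv T (fun t => (T - t) * e i t) 0) :
    ∃ (Λ : ℝ) (w : ι → ℝ), (∀ i, PowConv T (v i) (w i)) ∧ ∀ i, d i ≠ Λ → w i = 0 := by
  set lam : ℝ → ℝ := fun t => ∑ j, d j * v j t ^ 2 with hlam
  have hvB : ∀ i, ∀ᶠ t in 𝓝[<] T, |v i t| ≤ 1 := by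
    intro i
    filter_upwards [hv] with t ht
    rw [← sq_le_one_iff_abs_le_one, ← ht]
    exact Finset.single_le_sum (f := fun j => v j t ^ 2) (fun j _ => sq_nonneg _)
      (Finset.mem_univ i)
  have herr : PowConv T (fun t => ∑ i, 2 * d i * v i t * ((T - t) * e i t)) 0 := by
    have := PowConv.sum (T := T) Finset.univ (f := fun i t => 2 * d i * v i t * ((T - t) * e i t))
      (L := fun _ => 0) (fun i _ => (he i).zero_mul_of_bound (B := |2 * d i|) (by
        filter_upwards [hvB i] with t ht
        rw [abs_mul]
        exact mul_le_of_le_one_right (abs_nonneg _) ht))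
    simpa using this
  obtain ⟨δ, C, hδ, hC, herr⟩ := herr.bound
  -- The main term is the variance of the `d i` under the weights `v i ^ 2`, hence nonnegative when
  -- `K` is.
  have hlam' : ∀ᶠ t in 𝓝[<] T, HasDerivAt lam
      (2 * K t * (∑ i, (d i - lam t) ^ 2 * v i t ^ 2) + ∑ i, 2 * d i * v i t * e i t) t := by
    filter_upwards [hv, hd] with t h1 h2
    have h3 : HasDerivAt lam (∑ i, d i * (2 * v i t * (K t * (d i - lam t) * v i t + e i t))) t :=
      HasDerivAt.fun_sum fun i _ => by
        have := ((h2 i).pow 2).const_mul (d i)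
        exact this.congr_deriv (by simp [hlam])
    refine h3.congr_deriv ?_
    have h4 : ∑ i, d i * (2 * v i t * (K t * (d i - lam t) * v i t + e i t))
        = 2 * K t * (∑ i, (d i - lam t) ^ 2 * v i t ^ 2) + ∑ i, 2 * d i * v i t * e i t
          + 2 * K t * lam t * (∑ i, d i * v i t ^ 2 - lam t * ∑ i, v i t ^ 2) := by
      simp only [Finset.mul_sum, ← Finset.sum_sub_distrib, ← Finset.sum_add_distrib]
      exact Finset.sum_congr rfl fun i _ => by ring
    rw [h4, h1]
    simp [hlam]
  obtain ⟨Λ, hΛ, -⟩ := exists_tendsto_of_deriv_ge (C := C) (B := ∑ i, |d i|) hδ hlam' (by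
    filter_upwards [herr, hK, eventually_sub_pos T] with t h1 h2 h3
    have hK0 : 0 ≤ K t := (pos_of_mul_pos_right (ha.trans_le h2.1) h3.le).le
    have h4 : 0 ≤ 2 * K t * (∑ i, (d i - lam t) ^ 2 * v i t ^ 2) := by positivity
    have h5 : ∑ i, 2 * d i * v i t * ((T - t) * e i t)
        = (T - t) * ∑ i, 2 * d i * v i t * e i t := by
      rw [Finset.mul_sum]
      exact Finset.sum_congr rfl fun i _ => by ring
    rw [h5, Real.norm_eq_abs, abs_mul, abs_of_pos h3, ← le_div_iff₀' h3, mul_div_assoc,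
      ← Real.rpow_sub_one h3.ne'] at h1
    have := (abs_le.1 h1).1
    linarith) (by
    filter_upwards [eventually_all.2 hvB] with t ht
    refine Finset.sum_le_sum fun i _ => ?_
    refine (le_abs_self _).trans ?_
    rw [abs_mul, abs_pow]
    exact mul_le_of_le_one_right (abs_nonneg _) (pow_le_one₀ (abs_nonneg _) (ht i)))
  -- Once `lam` is close to `Λ`, the sign of `d i - lam` is that of `d i - Λ`, with a uniform gap.
  have hzero : ∀ i, d i ≠ Λ → PowConv T (v i) 0 := by
    intro i hi
    have hu : ∀ᶠ t in 𝓝[<] T, HasDerivAt (v i) ((K t * (d i - lam t)) * v i t + e i t) t :=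
      hd.mono fun t ht => ht i
    rcases hi.lt_or_gt with hi | hi
    · refine PowConv.zero_of_stable (μ := a * ((Λ - d i) / 2)) (B := 1)
        (mul_pos ha (by linarith)) hu ?_ (he i) (hvB i)
      filter_upwards [hK, hΛ.eventually (lt_mem_nhds (show (Λ + d i) / 2 < Λ by linarith))]
        with t h1 h2
      have h3 : a * ((Λ - d i) / 2) ≤ (T - t) * K t * (lam t - d i) :=
        mul_le_mul h1.1 (by linarith) (by linarith) (ha.le.trans h1.1)
      linarith
    · refine PowConv.zero_of_unstable (μ := a * ((d i - Λ) / 2)) (B := 1)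
        (mul_pos ha (by linarith)) hu ?_ (he i) (hvB i)
      filter_upwards [hK, hΛ.eventually (gt_mem_nhds (show Λ < (Λ + d i) / 2 by linarith))]
        with t h1 h2
      have h3 : a * ((d i - Λ) / 2) ≤ (T - t) * K t * (d i - lam t) :=
        mul_le_mul h1.1 (by linarith) (by linarith) (ha.le.trans h1.1)
      linarith
  -- On the unit sphere `Λ - lam = ∑ (Λ - d i) * v i ^ 2`, and only decaying modes contribute: the
  -- limit acquires a rate.
  have hlamΛ : PowConv T (fun t => Λ - lam t) 0 := by
    have h1 : PowConv T (fun t => ∑ i, (Λ - d i) * v i t * v i t) 0 := by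
      have := PowConv.sum (T := T) Finset.univ (f := fun i t => (Λ - d i) * v i t * v i t)
        (L := fun _ => 0) (fun i _ => by
          by_cases hi : d i = Λ
          · simpa [hi] using PowConv.const (T := T) (0 : ℝ)
          · refine (hzero i hi).zero_mul_of_bound (B := |Λ - d i|) ?_
            filter_upwards [hvB i] with t ht
            rw [abs_mul]
            exact mul_le_of_le_one_right (abs_nonneg _) ht)
      simpa using this
    refine h1.congr' ?_
    filter_upwards [hv] with t ht
    have : ∑ i, (Λ - d i) * v i t * v i t = Λ * (∑ i, v i t ^ 2) - lam t := by
      simp only [hlam, Finset.mul_sum, ← Finset.sum_sub_distrib]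
      exact Finset.sum_congr rfl fun i _ => by ring
    rw [this, ht, mul_one]
  have hconv : ∀ i, ∃ w, PowConv T (v i) w ∧ (d i ≠ Λ → w = 0) := by
    intro i
    by_cases hi : d i = Λ
    -- Here the linear rate is `K * (Λ - lam)`, which is now integrable.
    · obtain ⟨w, hw⟩ := PowConv.exists_of_deriv (hd.mono fun t ht => ht i) (by
        have h1 := (hlamΛ.zero_mul_of_bound (f := fun t => (T - t) * K t * v i t) (B := b) (by
          filter_upwards [hK, hvB i] with t h1 h2
          rw [abs_mul, abs_of_pos (ha.trans_le h1.1)]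
          exact (mul_le_of_le_one_right (ha.le.trans h1.1) h2).trans h1.2)).add (he i)
        rw [add_zero] at h1
        refine h1.congr' (Eventually.of_forall fun t => ?_)
        simp only [hlam, hi]
        ring) (hvB i)
      exact ⟨w, hw, fun h => absurd hi h⟩
    · exact ⟨0, hzero i hi, fun _ => rfl⟩
  choose w hw using hconv
  exact ⟨Λ, w, fun i => (hw i).1, fun i => (hw i).2⟩

/-! ### Polar coordinates and the size of the solution -/

/-- `c * (T - t) - m t` is nondecreasing near `T` with limit zero, hence nonpositive. -/
theorem eventually_mul_sub_le_of_deriv_le {T c : ℝ} {m m' : ℝ → ℝ}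
    (hm : ∀ᶠ t in 𝓝[<] T, HasDerivAt m (m' t) t) (hm' : ∀ᶠ t in 𝓝[<] T, m' t ≤ -c)
    (h0 : Tendsto m (𝓝[<] T) (𝓝 0)) : ∀ᶠ t in 𝓝[<] T, c * (T - t) ≤ m t := by
  have h2 : Tendsto (fun t => c * (T - t) - m t) (𝓝[<] T) (𝓝 0) := by
    simpa using ((tendsto_sub_rpow T one_pos).const_mul c).sub h0
  obtain ⟨L, hL, h3⟩ := exists_tendsto_of_deriv_ge (C := 0) (δ := 1) (B := 1)
    (u := fun t => c * (T - t) - m t) (u' := fun t => -c - m' t) one_pos (by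
      filter_upwards [hm] with t ht
      have := (((hasDerivAt_id t).const_sub T).const_mul c).sub ht
      exact this.congr_deriv (by ring)) (by
      filter_upwards [hm'] with t ht
      linarith) (by
      filter_upwards [h2.eventually (gt_mem_nhds one_pos)] with t ht
      exact ht.le)
  obtain rfl := tendsto_nhds_unique hL h2
  filter_upwards [h3] with t ht
  linarith

theorem eventually_le_mul_sub_of_le_deriv {T c : ℝ} {m m' : ℝ → ℝ}
    (hm : ∀ᶠ t in 𝓝[<] T, HasDerivAt m (m' t) t) (hm' : ∀ᶠ t in 𝓝[<] T, -c ≤ m' t)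
    (h0 : Tendsto m (𝓝[<] T) (𝓝 0)) : ∀ᶠ t in 𝓝[<] T, m t ≤ c * (T - t) := by
  have := eventually_mul_sub_le_of_deriv_le (T := T) (c := -c) (m := fun t => -m t)
    (m' := fun t => -m' t) (hm.mono fun t ht => ht.neg)
    (hm'.mono fun t ht => neg_le_neg ht) (by simpa using h0.neg)
  filter_upwards [this] with t ht
  linarith

/-- Derivative of the radius along `z' = p • F`. -/
theorem hasDerivAt_sqrt_sum_sq {ι : Type*} [Fintype ι] {z : ι → ℝ → ℝ} {F : ι → ℝ} {p t : ℝ}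
    (hN : 0 < √(∑ i, z i t ^ 2)) (hz : ∀ i, HasDerivAt (z i) (p * F i) t) :
    HasDerivAt (fun t => √(∑ i, z i t ^ 2))
      (p * ∑ i, z i t / √(∑ i, z i t ^ 2) * F i) t := by
  have h1 : HasDerivAt (fun t => ∑ i, z i t ^ 2) (∑ i, 2 * z i t * (p * F i)) t :=
    HasDerivAt.fun_sum fun i _ => ((hz i).pow 2).congr_deriv (by simp)
  refine (h1.sqrt (Real.sqrt_pos.1 hN).ne').congr_deriv ?_
  rw [Finset.sum_div, Finset.mul_sum]
  refine Finset.sum_congr rfl fun i _ => ?_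
  field_simp

/-- A perturbation of `z' = k N ^ α D z`, where `D` is a positive diagonal matrix and `N` is the
Euclidean norm of `z`, which blows up at `T`: the direction of `z` converges to an eigenvector of
`D`, and the size of `N` is determined by the limit of `k`. -/
theorem exists_powConv_polar {ι : Type*} [Fintype ι] [Nonempty ι] {T α c₁ c₂ : ℝ} (hα : 0 < α)
    (hc : 0 < c₁) (d : ι → ℝ) (hd : ∀ i, 0 < d i) (z γ : ι → ℝ → ℝ) (k N : ℝ → ℝ)
    (hNdef : ∀ t, N t = √(∑ i, z i t ^ 2)) (hN : Tendsto N (𝓝[<] T) atTop)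
    (hz : ∀ᶠ t in 𝓝[<] T, ∀ i,
      HasDerivAt (z i) (N t ^ (1 + α) * (k t * d i * (z i t / N t) + γ i t)) t)
    (hk : ∀ᶠ t in 𝓝[<] T, c₁ ≤ k t ∧ k t ≤ c₂) (hγ : ∀ i, PowConv T (γ i) 0) :
    ∃ (Λ : ℝ) (w : ι → ℝ), (∀ i, PowConv T (fun t => z i t / N t) (w i)) ∧
      (∀ i, d i ≠ Λ → w i = 0) ∧ ∑ i, w i ^ 2 = 1 ∧
      ∀ k₀, PowConv T k k₀ → PowConv T (fun t => N t ^ (-α) / (T - t)) (α * k₀ * Λ) := by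
  have hNpos : ∀ᶠ t in 𝓝[<] T, 0 < N t := hN.eventually_gt_atTop 0
  set v : ι → ℝ → ℝ := fun i t => z i t / N t with hvdef
  set lam : ℝ → ℝ := fun t => ∑ j, d j * v j t ^ 2 with hlam
  set e : ℝ → ℝ := fun t => ∑ j, v j t * γ j t with hedef
  have hv : ∀ᶠ t in 𝓝[<] T, ∑ i, v i t ^ 2 = 1 := by
    filter_upwards [hNpos] with t ht
    have : N t ^ 2 = ∑ i, z i t ^ 2 := by
      rw [hNdef, Real.sq_sqrt (Finset.sum_nonneg fun i _ => sq_nonneg _)]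
    simp only [hvdef, div_pow, ← Finset.sum_div, ← this]
    exact div_self (by positivity)
  have hvB : ∀ i, ∀ᶠ t in 𝓝[<] T, |v i t| ≤ 1 := by
    intro i
    filter_upwards [hv] with t ht
    rw [← sq_le_one_iff_abs_le_one, ← ht]
    exact Finset.single_le_sum (f := fun j => v j t ^ 2) (fun j _ => sq_nonneg _)
      (Finset.mem_univ i)
  have he : PowConv T e 0 := by
    have := PowConv.sum (T := T) Finset.univ (f := fun i t => v i t * γ i t)
      (L := fun _ => 0) (fun i _ => (hγ i).zero_mul_of_bound (hvB i))
    simpa using this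
  have hN' : ∀ᶠ t in 𝓝[<] T, HasDerivAt N (N t ^ (1 + α) * (k t * lam t + e t)) t := by
    filter_upwards [hNpos, hz] with t h1 h2
    have h3 := hasDerivAt_sqrt_sum_sq (hNdef t ▸ h1) h2
    rw [← funext hNdef, ← hNdef] at h3
    refine h3.congr_deriv ?_
    simp only [hlam, hedef, hvdef, Finset.mul_sum, ← Finset.sum_add_distrib]
    exact Finset.sum_congr rfl fun i _ => by ring
  have hv' : ∀ᶠ t in 𝓝[<] T, ∀ i, HasDerivAt (v i)
      (N t ^ α * k t * (d i - lam t) * v i t + N t ^ α * (γ i t - v i t * e t)) t := by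
    filter_upwards [hNpos, hz, hN'] with t h1 h2 h3 i
    refine ((h2 i).div h3 h1.ne').congr_deriv ?_
    rw [Real.rpow_add h1, Real.rpow_one]
    simp only [hvdef]
    field_simp
    ring
  -- The power `-α` removes all powers of `N` from the radial equation.
  have hm' : ∀ᶠ t in 𝓝[<] T, HasDerivAt (fun t => N t ^ (-α)) (-α * (k t * lam t + e t)) t := by
    filter_upwards [hNpos, hN'] with t h1 h2
    refine (h2.rpow_const (Or.inl h1.ne')).congr_deriv ?_
    have : N t ^ (1 + α) * N t ^ (-α - 1) = 1 := by
      rw [← Real.rpow_add h1, show 1 + α + (-α - 1) = 0 by ring, Real.rpow_zero]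
    linear_combination (-α * (k t * lam t + e t)) * this
  have hm0 : Tendsto (fun t => N t ^ (-α)) (𝓝[<] T) (𝓝 0) :=
    (tendsto_rpow_neg_atTop hα).comp hN
  obtain ⟨i₁, hi₁⟩ := Finite.exists_min d
  obtain ⟨i₂, hi₂⟩ := Finite.exists_max d
  have hlamB : ∀ᶠ t in 𝓝[<] T, d i₁ ≤ lam t ∧ lam t ≤ d i₂ := by
    filter_upwards [hv] with t ht
    constructor
    · rw [← mul_one (d i₁), ← ht, Finset.mul_sum]
      exact Finset.sum_le_sum fun i _ => mul_le_mul_of_nonneg_right (hi₁ i) (sq_nonneg _)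
    · rw [← mul_one (d i₂), ← ht, Finset.mul_sum]
      exact Finset.sum_le_sum fun i _ => mul_le_mul_of_nonneg_right (hi₂ i) (sq_nonneg _)
  have hp : 0 < c₁ * d i₁ := mul_pos hc (hd i₁)
  -- The vanishing error `e` costs at most half of the lower bound and at most `1` in the upper one.
  have hsize : ∀ᶠ t in 𝓝[<] T, c₁ * d i₁ / 2 ≤ k t * lam t + e t ∧
      k t * lam t + e t ≤ c₂ * d i₂ + 1 := by
    filter_upwards [hk, hlamB, he.tendsto.eventually (gt_mem_nhds one_pos),
      he.tendsto.eventually (lt_mem_nhds (show -(c₁ * d i₁ / 2) < 0 by linarith))]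
      with t h1 h2 h3 h4
    have h5 : c₁ * d i₁ ≤ k t * lam t :=
      mul_le_mul h1.1 h2.1 (hd i₁).le (hc.le.trans h1.1)
    have h6 : k t * lam t ≤ c₂ * d i₂ :=
      mul_le_mul h1.2 h2.2 ((hd i₁).le.trans h2.1) (hc.le.trans (h1.1.trans h1.2))
    constructor <;> linarith
  have hlow := eventually_mul_sub_le_of_deriv_le (c := α * (c₁ * d i₁ / 2)) hm' (by
    filter_upwards [hsize] with t ht
    have := mul_le_mul_of_nonneg_left ht.1 hα.le
    linarith) hm0
  have hupp := eventually_le_mul_sub_of_le_deriv (c := α * (c₂ * d i₂ + 1)) hm' (by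
    filter_upwards [hsize] with t ht
    have := mul_le_mul_of_nonneg_left ht.2 hα.le
    linarith) hm0
  -- No sign of `c₂` is assumed; positivity is read off from `hsize` at one instant.
  have hq : 0 < c₂ * d i₂ + 1 := by
    obtain ⟨t, ht⟩ := hsize.exists
    linarith [ht.1.trans ht.2]
  have hK : ∀ᶠ t in 𝓝[<] T, (α * (c₂ * d i₂ + 1))⁻¹ ≤ (T - t) * N t ^ α ∧
      (T - t) * N t ^ α ≤ (α * (c₁ * d i₁ / 2))⁻¹ := by
    filter_upwards [hlow, hupp, hNpos, eventually_sub_pos T] with t h1 h2 h3 h4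
    rw [Real.rpow_neg h3.le] at h1 h2
    have h5 : 0 < N t ^ α := Real.rpow_pos_of_pos h3 α
    constructor
    · rw [inv_le_iff_one_le_mul₀' (by positivity)]
      rw [inv_le_iff_one_le_mul₀ h5] at h2
      linarith
    · rw [le_inv_comm₀ (by positivity) (by positivity), mul_inv, ← div_eq_inv_mul,
        le_div_iff₀ h4]
      exact h1
  have hK2 : ∀ᶠ t in 𝓝[<] T,
      (α * (c₂ * d i₂ + 1))⁻¹ * c₁ ≤ (T - t) * (N t ^ α * k t) ∧
      (T - t) * (N t ^ α * k t) ≤ (α * (c₁ * d i₁ / 2))⁻¹ * c₂ := by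
    filter_upwards [hK, hk] with t h1 h2
    rw [← mul_assoc]
    have h3 : 0 < (α * (c₂ * d i₂ + 1))⁻¹ := by positivity
    exact ⟨mul_le_mul h1.1 h2.1 hc.le (h3.le.trans h1.1),
      mul_le_mul h1.2 h2.2 (hc.le.trans h2.1) (by positivity)⟩
  obtain ⟨Λ, w, hw, hw0⟩ := exists_powConv_direction (T := T) (by positivity) d v
    (fun i t => N t ^ α * (γ i t - v i t * e t)) (fun t => N t ^ α * k t) hv hv' hK2 (by
      intro i
      have h1 : PowConv T (fun t => γ i t + (-v i t) * e t) 0 := by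
        have := (hγ i).add (he.zero_mul_of_bound (f := fun t => -v i t) (B := 1)
          (by simpa using hvB i))
        simpa using this
      refine (h1.zero_mul_of_bound (f := fun t => (T - t) * N t ^ α) (by
        filter_upwards [hK] with t ht
        rw [abs_of_nonneg (le_trans (by positivity) ht.1)]
        exact ht.2)).congr' (Eventually.of_forall fun t => ?_)
      ring)
  have hw1 : ∑ i, w i ^ 2 = 1 := by
    refine tendsto_nhds_unique (tendsto_finsetSum _ fun i _ => (hw i).tendsto.pow 2) ?_
    exact tendsto_const_nhds.congr' (hv.mono fun t ht => ht.symm)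
  -- The limit of `k` enters only now: in the application it is known only once the direction has
  -- converged.
  refine ⟨Λ, w, hw, hw0, hw1, fun k₀ hk₀ => ?_⟩
  have hlamΛ : PowConv T lam Λ := by
    have h1 := PowConv.sum (T := T) Finset.univ (f := fun i t => d i * (v i t * v i t))
      (L := fun i => d i * (w i * w i))
      fun i _ => (PowConv.const (d i)).mul ((hw i).mul (hw i))
    have h2 : ∑ i, d i * (w i * w i) = Λ := by
      rw [← mul_one Λ, ← hw1, Finset.mul_sum]
      refine Finset.sum_congr rfl fun i _ => ?_
      by_cases hi : d i = Λ
      · rw [hi, sq]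
      · simp [hw0 i hi]
    rw [h2] at h1
    simpa only [hlam, sq] using h1
  refine PowConv.div_sub_of_deriv hm' ?_ hm0
  have h1 := (PowConv.const (-α)).mul ((hk₀.mul hlamΛ).add he)
  convert h1 using 1
  ring

/-! ### Homogeneous functions and diagonalization -/

theorem PowConv.euclideanSpace {ι : Type*} [Fintype ι] {T : ℝ} {f : ℝ → EuclideanSpace ℝ ι}
    {L : EuclideanSpace ℝ ι} (h : ∀ i, PowConv T (fun t => f t i) (L i)) : PowConv T f L := by
  classical
  have h1 := PowConv.sum (T := T) Finset.univ
    fun i _ => (h i).smul (PowConv.const (EuclideanSpace.basisFun ι ℝ i))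
  have h2 : ∀ x : EuclideanSpace ℝ ι, ∑ i, x i • EuclideanSpace.basisFun ι ℝ i = x := fun x => by
    simpa using (EuclideanSpace.basisFun ι ℝ).sum_repr x
  simpa only [h2] using h1

theorem PosHomogeneous.apply_eq {n : ℕ} {β : ℝ} {F : EuclideanSpace ℝ (Fin n) → ℝ}
    (hF : PosHomogeneous β F) {x : EuclideanSpace ℝ (Fin n)} (hx : x ≠ 0) :
    F x = ‖x‖ ^ β * F (‖x‖⁻¹ • x) := by
  have h := norm_pos_iff.2 hx
  rw [← hF _ (smul_ne_zero (inv_ne_zero h.ne') hx) _ h, smul_inv_smul₀ h.ne']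

theorem inv_norm_smul_mem_unit_sphere {E : Type*} [NormedAddCommGroup E] [NormedSpace ℝ E] {x : E}
    (hx : x ≠ 0) : ‖x‖⁻¹ • x ∈ Metric.sphere (0 : E) 1 := by
  rw [mem_sphere_zero_iff_norm, norm_smul, norm_inv, norm_norm,
    inv_mul_cancel₀ (norm_ne_zero_iff.2 hx)]

/-- (HC) is available only on the sphere, so `H` is split into a power of the norm, differentiable
away from zero, and its value at the normalized point. -/
theorem PosHomogeneous.powConv {n : ℕ} {α T : ℝ} {H : EuclideanSpace ℝ (Fin n) → ℝ}
    (hH : PosHomogeneous α H)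
    (hHC : PropertyHC (Metric.sphere (0 : EuclideanSpace ℝ (Fin n)) 1) H)
    {x : ℝ → EuclideanSpace ℝ (Fin n)} {x₀ : EuclideanSpace ℝ (Fin n)} (hx : PowConv T x x₀)
    (hx₀ : x₀ ≠ 0) : PowConv T (fun t => H (x t)) (H x₀) := by
  have hn := norm_pos_iff.2 hx₀
  have hne : ∀ᶠ t in 𝓝[<] T, x t ≠ 0 := hx.tendsto.eventually_ne hx₀
  have h1 : PowConv T (fun t => ‖x t‖⁻¹ • x t) (‖x₀‖⁻¹ • x₀) :=
    (hx.norm.comp_differentiableAt (φ := fun r => r⁻¹) (differentiableAt_inv hn.ne')).smul hx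
  obtain ⟨r, C, γ, hr, hC, hγ, h2⟩ := hHC _ (inv_norm_smul_mem_unit_sphere hx₀)
  have h3 := (hx.norm.comp_differentiableAt (φ := fun r => r ^ α)
    (Real.differentiableAt_rpow_const_of_ne α hn.ne')).mul
    (h1.comp_holder (hne.mono fun t ht => inv_norm_smul_mem_unit_sphere ht) hr hγ hC h2)
  rw [← hH.apply_eq hx₀] at h3
  exact h3.congr' (hne.mono fun t ht => (hH.apply_eq ht).symm)

/-- The linear change of variables that diagonalizes a real diagonalizable matrix. -/
theorem RealDiagonalizable.exists_continuousLinearMap {n : ℕ} {A : Matrix (Fin n) (Fin n) ℝ}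
    (hA : RealDiagonalizable A) :
    ∃ (P Q : EuclideanSpace ℝ (Fin n) →L[ℝ] EuclideanSpace ℝ (Fin n)) (d : Fin n → ℝ),
      (∀ x, Q (P x) = x) ∧ (∀ x, P (Q x) = x) ∧
      ∀ x i, P (Matrix.toEuclideanLin A x) i = d i * P x i := by
  obtain ⟨S, d, hS, rfl⟩ := hA
  have hdet := (Matrix.isUnit_iff_isUnit_det S).1 hS
  refine ⟨(Matrix.toEuclideanLin S).toContinuousLinearMap,
    (Matrix.toEuclideanLin S⁻¹).toContinuousLinearMap, d, fun x => ?_, fun x => ?_, fun x i => ?_⟩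
  · simp [Matrix.toLpLin_apply, Matrix.nonsing_inv_mul S hdet]
  · simp [Matrix.toLpLin_apply, Matrix.mul_nonsing_inv S hdet]
  · have h : S * (S⁻¹ * Matrix.diagonal d * S) = Matrix.diagonal d * S := by
      rw [mul_assoc, Matrix.mul_nonsing_inv_cancel_left S _ hdet]
    simp only [LinearMap.coe_toContinuousLinearMap', Matrix.toLpLin_apply, Matrix.mulVec_mulVec, h]
    rw [← Matrix.mulVec_mulVec, Matrix.mulVec_diagonal]

/-! ### The main theorem -/

theorem mainTheorem6 (n : ℕ) (hn : 1 ≤ n)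
    (A : Matrix (Fin n) (Fin n) ℝ) (hA : RealDiagonalizable A)
    (hApos : ∀ μ : ℝ, Module.End.HasEigenvalue (Matrix.toEuclideanLin A) μ → 0 < μ)
    (α : ℝ) (hα : 0 < α)
    (H : EuclideanSpace ℝ (Fin n) → ℝ) (hH : PosHomogeneous α H)
    (hHpos : ∀ x ∈ Metric.sphere (0 : EuclideanSpace ℝ (Fin n)) 1, 0 < H x)
    (hHcont : ContinuousOn H (Metric.sphere (0 : EuclideanSpace ℝ (Fin n)) 1))
    (hHC : PropertyHC (Metric.sphere (0 : EuclideanSpace ℝ (Fin n)) 1) H)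
    (t₀ T : ℝ) (ht₀ : 0 ≤ t₀) (hT : t₀ < T)
    (f : ℝ → EuclideanSpace ℝ (Fin n)) (hf : ContinuousOn f (Ico t₀ T))
    (y : ℝ → EuclideanSpace ℝ (Fin n)) (hy : IsBlowUpSolution A H f t₀ T y)
    (M δ : ℝ) (hM : 0 < M) (hδ : 0 < δ)
    (hfE : ∀ t ∈ Ico t₀ T, ‖f t‖ ≤ ‖y t‖ ^ (1 + α) * (M * (T - t) ^ δ)) :
    ∃ (ξ : EuclideanSpace ℝ (Fin n)) (Λ : ℝ),
      Module.End.HasEigenvector (Matrix.toEuclideanLin A) Λ ξ ∧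
      α * Λ * H ξ = 1 ∧
      ∃ ε : ℝ, 0 < ε ∧
        (fun t => ‖(T - t) ^ (1 / α) • y t - ξ‖) =O[𝓝[<] T] (fun t => (T - t) ^ ε) := by
  have : Nonempty (Fin n) := ⟨⟨0, hn⟩⟩
  have : Nontrivial (EuclideanSpace ℝ (Fin n)) :=
    ⟨⟨EuclideanSpace.single ⟨0, hn⟩ 1, 0, by simp⟩⟩
  obtain ⟨P, Q, d, hQP, hPQ, hPA⟩ := hA.exists_continuousLinearMap
  have hPinj : Function.Injective P := Function.LeftInverse.injective hQP
  have heig : ∀ (x : EuclideanSpace ℝ (Fin n)) (μ : ℝ), (∀ i, d i * P x i = μ * P x i) →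
      x ≠ 0 → Module.End.HasEigenvector (Matrix.toEuclideanLin A) μ x := by
    intro x μ h hx
    refine Module.End.hasEigenvector_iff.2 ⟨Module.End.mem_eigenspace_iff.2 (hPinj ?_), hx⟩
    ext i
    rw [hPA, h, map_smul, PiLp.smul_apply, smul_eq_mul]
  have hd : ∀ i, 0 < d i := by
    intro i
    refine hApos _ (Module.End.hasEigenvalue_of_hasEigenvector
      (heig (Q (EuclideanSpace.single i 1)) (d i) (fun j => ?_) fun h => ?_))
    · rw [hPQ]
      by_cases hj : j = i
      · rw [hj]
      · simp [hj]
    · have := congrArg P h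
      rw [hPQ, map_zero] at this
      simp at this
  have hIoo : ∀ᶠ t in 𝓝[<] T, t ∈ Ioo t₀ T := Ioo_mem_nhdsLT hT
  -- Adding `1` makes the constants positive without discussion of the operator norms.
  set p := ‖P‖ + 1
  set q := ‖Q‖ + 1
  have hp : 0 < p := by positivity
  have hq : 0 < q := by positivity
  set N : ℝ → ℝ := fun t => ‖P (y t)‖ with hN
  have hyN : ∀ t, ‖y t‖ ≤ q * N t := fun t => by
    have h1 := Q.le_opNorm (P (y t))
    rw [hQP] at h1
    exact h1.trans (mul_le_mul_of_nonneg_right (by simp [q]) (norm_nonneg _))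
  have hNy : ∀ t, N t ≤ p * ‖y t‖ := fun t =>
    (P.le_opNorm (y t)).trans (mul_le_mul_of_nonneg_right (by simp [p]) (norm_nonneg _))
  have hNlim : Tendsto N (𝓝[<] T) atTop :=
    tendsto_atTop_mono (fun t => (div_le_iff₀' hq).2 (hyN t)) (hy.tendsto_norm.atTop_div_const hq)
  have hy0 : ∀ᶠ t in 𝓝[<] T, y t ≠ 0 := hIoo.mono fun t ht => hy.ne_zero t ⟨ht.1.le, ht.2⟩
  have hNpos : ∀ᶠ t in 𝓝[<] T, 0 < N t := hNlim.eventually_gt_atTop 0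
  have hcomp := isCompact_sphere (0 : EuclideanSpace ℝ (Fin n)) 1
  have hne : (Metric.sphere (0 : EuclideanSpace ℝ (Fin n)) 1).Nonempty :=
    NormedSpace.sphere_nonempty.2 zero_le_one
  obtain ⟨x₁, hx₁, hmin⟩ := hcomp.exists_isMinOn hne hHcont
  obtain ⟨x₂, hx₂, hmax⟩ := hcomp.exists_isMaxOn hne hHcont
  -- `y / N` is not a unit vector, since `N` is the norm of `P y`; its norm lies in `[p⁻¹, q]`, and
  -- homogeneity turns the extrema of `H` on the sphere into bounds on `k`.
  set k : ℝ → ℝ := fun t => H ((N t)⁻¹ • y t) with hk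
  have hHk : ∀ᶠ t in 𝓝[<] T, H (y t) = N t ^ α * k t := by
    filter_upwards [hy0, hNpos] with t h1 h2
    rw [hk, ← hH _ (smul_ne_zero (inv_ne_zero h2.ne') h1) _ h2, smul_inv_smul₀ h2.ne']
  have hkB : ∀ᶠ t in 𝓝[<] T, p⁻¹ ^ α * H x₁ ≤ k t ∧ k t ≤ q ^ α * H x₂ := by
    filter_upwards [hy0, hNpos] with t h1 h2
    have h3 : (N t)⁻¹ • y t ≠ 0 := smul_ne_zero (inv_ne_zero h2.ne') h1
    have h4 := inv_norm_smul_mem_unit_sphere h3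
    have h5 : ‖(N t)⁻¹ • y t‖ = (N t)⁻¹ * ‖y t‖ := by
      rw [norm_smul, norm_inv, Real.norm_of_nonneg h2.le]
    have h6 : p⁻¹ ≤ ‖(N t)⁻¹ • y t‖ := by
      rw [h5, ← div_eq_inv_mul, le_div_iff₀ h2, inv_mul_le_iff₀ hp]
      exact hNy t
    have h7 : ‖(N t)⁻¹ • y t‖ ≤ q := by
      rw [h5, inv_mul_le_iff₀ h2, mul_comm]
      exact hyN t
    simp only [hk]
    rw [hH.apply_eq h3]
    have h8 := hHpos _ hx₁
    have h9 := hHpos _ h4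
    constructor
    · gcongr
      exact hmin h4
    · gcongr
      exact hmax h4
  obtain ⟨Λ, w, hw, hw0, hw1, hrad⟩ := exists_powConv_polar (T := T) hα
    (mul_pos (by positivity) (hHpos _ hx₁)) d hd (fun i t => P (y t) i)
    (fun i t => P (f t) i / N t ^ (1 + α)) k N
    (fun t => by simp [hN, EuclideanSpace.norm_eq]) hNlim (by
      filter_upwards [hIoo, hHk, hNpos] with t h1 h2 h3 i
      have h4 := (EuclideanSpace.proj (𝕜 := ℝ) i).hasFDerivAt.comp_hasDerivAt t
        (P.hasFDerivAt.comp_hasDerivAt t (hy.hasDerivAt t h1))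
      refine h4.congr_deriv ?_
      have h5 : 0 < N t ^ α := by positivity
      change P (H (y t) • Matrix.toEuclideanLin A (y t) + f t) i = _
      simp only [map_add, map_smul, PiLp.add_apply, PiLp.smul_apply, hPA, h2, smul_eq_mul]
      rw [Real.rpow_add h3, Real.rpow_one]
      field_simp) hkB (by
      intro i
      refine .of_bound hδ (C := p * (q ^ (1 + α) * M)) ?_
      filter_upwards [hIoo, hNpos, eventually_sub_pos T] with t h1 h2 h3
      rw [sub_zero, norm_div, Real.norm_of_nonneg (Real.rpow_nonneg h2.le _),
        div_le_iff₀ (by positivity)]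
      calc ‖P (f t) i‖ ≤ ‖P (f t)‖ := PiLp.norm_apply_le _ i
        _ ≤ p * ‖f t‖ :=
          (P.le_opNorm _).trans (mul_le_mul_of_nonneg_right (by simp [p]) (norm_nonneg _))
        _ ≤ p * (‖y t‖ ^ (1 + α) * (M * (T - t) ^ δ)) := by
          gcongr
          exact hfE t ⟨h1.1.le, h1.2⟩
        _ ≤ p * ((q * N t) ^ (1 + α) * (M * (T - t) ^ δ)) := by
          gcongr
          exact hyN t
        _ = p * (q ^ (1 + α) * M) * (T - t) ^ δ * N t ^ (1 + α) := by
          rw [Real.mul_rpow hq.le h2.le]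
          ring)
  set W : EuclideanSpace ℝ (Fin n) := WithLp.toLp 2 w with hW
  have hW0 : W ≠ 0 := by
    intro h
    have h1 : ∀ i, w i = 0 := fun i => by simpa [hW] using congrArg (fun x => x i) h
    simp [h1] at hw1
  set x₀ := Q W with hx₀
  have hPx₀ : P x₀ = W := hPQ W
  have hx₀0 : x₀ ≠ 0 := by
    intro h
    rw [h, map_zero] at hPx₀
    exact hW0 hPx₀.symm
  have hdir : PowConv T (fun t => (N t)⁻¹ • y t) x₀ := by
    have h1 : PowConv T (fun t => (N t)⁻¹ • P (y t)) W := PowConv.euclideanSpace fun i => by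
      simpa [hW, div_eq_inv_mul] using hw i
    have h2 := h1.comp_differentiableAt (φ := Q) Q.differentiableAt
    simpa only [map_smul, hQP] using h2
  have hxeig := heig x₀ Λ (fun i => by
    rw [hPx₀]
    by_cases hi : d i = Λ
    · rw [hi]
    · simp [hW, hw0 i hi]) hx₀0
  have hΛ : 0 < Λ := hApos _ (Module.End.hasEigenvalue_of_hasEigenvector hxeig)
  have hHx₀ : 0 < H x₀ := by
    rw [hH.apply_eq hx₀0]
    exact mul_pos (Real.rpow_pos_of_pos (norm_pos_iff.2 hx₀0) _)
      (hHpos _ (inv_norm_smul_mem_unit_sphere hx₀0))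
  have hrad := hrad _ (hH.powConv hHC hdir hx₀0)
  -- Since `N ^ (-α) / (T - t)` tends to `c`, `(T - t) ^ (1 / α) * N` tends to `c ^ (-(1 / α))`, the
  -- factor that scales `x₀` to `ξ`.
  set c := α * H x₀ * Λ with hc
  have hcpos : 0 < c := by positivity
  have hr : 0 < c ^ (-(1 / α)) := Real.rpow_pos_of_pos hcpos _
  have hlim : PowConv T (fun t => (T - t) ^ (1 / α) • y t) (c ^ (-(1 / α)) • x₀) := by
    have h1 := (hrad.comp_differentiableAt (φ := fun r => r ^ (-(1 / α)))
      (Real.differentiableAt_rpow_const_of_ne _ hcpos.ne')).smul hdir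
    refine h1.congr' ?_
    filter_upwards [hNpos, eventually_sub_pos T] with t h2 h3
    rw [Real.div_rpow (by positivity) h3.le, ← Real.rpow_mul h2.le, smul_smul]
    congr 1
    rw [show -α * -(1 / α) = 1 by field_simp, Real.rpow_one, Real.rpow_neg h3.le]
    field_simp
  refine ⟨c ^ (-(1 / α)) • x₀, Λ, heig _ _ (fun i => ?_) (smul_ne_zero hr.ne' hx₀0), ?_, ?_⟩
  · have h := hxeig.apply_eq_smul
    have h2 := congrArg (fun x => P x i) h
    simp only [hPA, map_smul, PiLp.smul_apply, smul_eq_mul] at h2 ⊢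
    linear_combination c ^ (-(1 / α)) * h2
  -- By homogeneity `H ξ = c⁻¹ * H x₀`, and `c = α * H x₀ * Λ` gives the normalization.
  · rw [hH _ hx₀0 _ hr, ← Real.rpow_mul hcpos.le, show -(1 / α) * α = -1 by field_simp,
      Real.rpow_neg_one]
    rw [hc]
    field_simp
  · obtain ⟨ε, hε, h⟩ := hlim
    exact ⟨ε, hε, h.norm_left⟩
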